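/- Let $R$ be a commutative ring, let $x = x_1,\dots,x_k$ be a finite sequence of elements of $R$, and for $n\ge 1$ put $x^{(n)} = x_1^n,\dots,x_k^n$. The sequence $x$ is called weakly proregular if for every $i>0$ and every $n\ge 1$ there is an $m\ge n$ such that the natural map of Koszul homology modules $H_i(x^{(m)};R)\to H_i(x^{(n)};R)$ (induced by $e_{j}\mapsto x_{j}^{m-n}e_{j}$ on Koszul complexes) is zero. For $y\in R$ let $L_y$ be the complex of free $R$-modules $R\oplus R[T]\to R[T]$, $(r,f)\mapsto r+(1-yT)f$, in cohomological degrees $0$ and $1$; it is a free resolution of the Čech complex $R\to R_y$. Put $L_x = L_{x_1}\otimes_R\cdots\otimes_R L_{x_k}$, a bounded free resolution of the Čech complex $\check C_x$, and for an $R$-module $M$ define the Čech homology $\check H^x_i(M) = H_i(\operatorname{Hom}_R(L_x,M))$. Let $E$ be an injective cogenerator in the category of $R$-modules. Then the following conditions are equivalent: (i) The sequence $x$ is weakly proregular. (ii) $\check H^x_i(\operatorname{Hom}_R(I,J))=0$ for all $i>0$ and all injective $R$-modules $I$ and $J$. (iii) $\check H^x_i(\operatorname{Hom}_R(I,E))=0$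 for all $i>0$ and all injective $R$-modules $I$. -/

import Mathlib

open CategoryTheory

universe u

noncomputable section

namespace CechKoszul


/-- The sign `(-1)^#{i ∈ S | i < j}` of exterior multiplication by, or contraction with, the
`j`-th basis vector. -/
def sgn {k : ℕ} (S : Finset (Fin k)) (j : Fin k) : ℤ :=
  (-1) ^ (S.filter (· < j)).card

lemma sgn_mul_sgn_insert {k : ℕ} {S : Finset (Fin k)} {j l : Fin k} (hj : j ∉ S) (hl : l ∉ S)
    (hjl : j ≠ l) :
    sgn S j * sgn (insert j S) l + sgn S l * sgn (insert l S) j = 0 := by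
  have aux : ∀ a b : Fin k, a ∉ S → a < b →
      sgn S a * sgn (insert a S) b + sgn S b * sgn (insert b S) a = 0 := by
    intro a b ha hab
    have h1 : ((insert a S).filter (· < b)).card = (S.filter (· < b)).card + 1 := by
      rw [Finset.filter_insert, if_pos hab, Finset.card_insert_of_notMem]
      simp [ha]
    have h2 : (insert b S).filter (· < a) = S.filter (· < a) := by
      rw [Finset.filter_insert, if_neg (not_lt.mpr hab.le)]
    simp only [sgn, h1, h2, pow_succ]
    ring
  rcases lt_or_gt_of_ne hjl with h | h
  · exact aux j l hj h
  · rw [add_comm]; exact aux l j hl h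

lemma sgn_erase {k : ℕ} (S : Finset (Fin k)) (j : Fin k) : sgn (S.erase j) j = sgn S j := by
  unfold sgn
  congr 2
  ext i
  simp only [Finset.mem_filter, Finset.mem_erase]
  constructor
  · rintro ⟨⟨_, h⟩, h'⟩; exact ⟨h, h'⟩
  · rintro ⟨h, h'⟩; exact ⟨⟨h'.ne, h⟩, h'⟩

section Koszul

variable {R : Type u} [CommRing R] {k : ℕ} {N : Type u} [AddCommGroup N] [Module R N]

/-- The degree `p` part `⋀^p (R^k) ⊗ N` of the Koszul complexes with coefficients in `N`: an
element is given by its coefficients at the `e_S`, with `S` a `p`-element subset of the index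
set. -/
abbrev KoszulTerm (k : ℕ) (N : Type u) (p : ℕ) : Type u :=
  {S : Finset (Fin k) // S.card = p} → N

/-- The Koszul boundary for a family `φ` of endomorphisms of `N`,
`n e_{j_0 ⋯ j_p} ↦ ∑_r (-1)^r φ_{j_r}(n) e_{j_0 ⋯ (omit j_r) ⋯ j_p}`, in coefficients. -/
def koszulBoundary (φ : Fin k → Module.End R N) (p : ℕ) :
    KoszulTerm k N (p + 1) →ₗ[R] KoszulTerm k N p where
  toFun f S := ∑ j : {j : Fin k // j ∉ S.1},
    sgn S.1 j.1 • φ j.1 (f ⟨insert j.1 S.1, by rw [Finset.card_insert_of_notMem j.2, S.2]⟩)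
  map_add' f g := by
    funext S
    simp [Finset.sum_add_distrib]
  map_smul' r f := by
    funext S
    simp [Finset.smul_sum, smul_comm r]

/-- The Koszul coboundary for a family `φ` of endomorphisms of `N`,
`n e_S ↦ ∑_{j ∉ S} φ_j(n) (e_j ∧ e_S)`, in coefficients. -/
def koszulCoboundary (φ : Fin k → Module.End R N) (p : ℕ) :
    KoszulTerm k N p →ₗ[R] KoszulTerm k N (p + 1) where
  toFun f S := ∑ j : {j : Fin k // j ∈ S.1},
    sgn S.1 j.1 • φ j.1 (f ⟨S.1.erase j.1, by rw [Finset.card_erase_of_mem j.2, S.2]; rfl⟩)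
  map_add' f g := by
    funext S
    simp [Finset.sum_add_distrib]
  map_smul' r f := by
    funext S
    simp [Finset.smul_sum, smul_comm r]

lemma koszulBoundary_comp (φ : Fin k → Module.End R N) (hφ : ∀ i j, Commute (φ i) (φ j))
    (p : ℕ) : koszulBoundary φ p ∘ₗ koszulBoundary φ (p + 1) = 0 := by
  refine LinearMap.ext fun f => ?_
  funext S
  simp only [koszulBoundary, LinearMap.comp_apply, LinearMap.coe_mk, AddHom.coe_mk, map_sum,
    Finset.smul_sum, LinearMap.zero_apply, Pi.zero_apply]
  rw [Finset.sum_sigma']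
  refine Finset.sum_involution
    (fun a _ => ⟨⟨a.2.1, fun h => a.2.2 (Finset.mem_insert_of_mem h)⟩,
      ⟨a.1.1, fun h => (Finset.mem_insert.mp h).elim
        (fun h' => a.2.2 (Finset.mem_insert.mpr (Or.inl h'.symm))) a.1.2⟩⟩) ?_ ?_ ?_ ?_
  · rintro ⟨⟨j, hj⟩, ⟨l, hl⟩⟩ _
    have hjl : j ≠ l := fun h => hl (by simp [h])
    have hl' : l ∉ S.1 := fun h => hl (Finset.mem_insert_of_mem h)
    have hc : ∀ n, φ j (φ l n) = φ l (φ j n) := fun n => LinearMap.congr_fun (hφ j l) n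
    simp only [map_zsmul, smul_smul, hc, Finset.insert_comm l j]
    rw [← add_smul, sgn_mul_sgn_insert hj hl' hjl, zero_smul]
  · rintro ⟨⟨j, hj⟩, ⟨l, hl⟩⟩ _ _ h
    have h1 := congrArg (fun a : Σ j : {j : Fin k // j ∉ S.1}, {l // l ∉ insert j.1 S.1} => a.1.1) h
    exact hl (by simp only at h1; simp [h1])
  · intros; exact Finset.mem_sigma.mpr ⟨Finset.mem_univ _, Finset.mem_univ _⟩
  · intros; rfl

lemma koszulCoboundary_comp (φ : Fin k → Module.End R N) (hφ : ∀ i j, Commute (φ i) (φ j))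
    (p : ℕ) : koszulCoboundary φ (p + 1) ∘ₗ koszulCoboundary φ p = 0 := by
  refine LinearMap.ext fun f => ?_
  funext S
  simp only [koszulCoboundary, LinearMap.comp_apply, LinearMap.coe_mk, AddHom.coe_mk, map_sum,
    Finset.smul_sum, LinearMap.zero_apply, Pi.zero_apply]
  rw [Finset.sum_sigma']
  refine Finset.sum_involution
    (fun a _ => ⟨⟨a.2.1, Finset.mem_of_mem_erase a.2.2⟩,
      ⟨a.1.1, Finset.mem_erase.mpr ⟨(Finset.ne_of_mem_erase a.2.2).symm, a.1.2⟩⟩⟩) ?_ ?_ ?_ ?_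
  · rintro ⟨⟨j, hj⟩, ⟨l, hl⟩⟩ _
    have hlj : l ≠ j := Finset.ne_of_mem_erase hl
    have hl' : l ∈ S.1 := Finset.mem_of_mem_erase hl
    have hc : ∀ n, φ j (φ l n) = φ l (φ j n) := fun n => LinearMap.congr_fun (hφ j l) n
    have key := sgn_mul_sgn_insert (S := (S.1.erase j).erase l) (j := j) (l := l)
      (by simp) (by simp) hlj.symm
    have e1 : insert j ((S.1.erase j).erase l) = S.1.erase l := by
      rw [Finset.erase_right_comm, Finset.insert_erase (Finset.mem_erase.mpr ⟨hlj.symm, hj⟩)]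
    have e2 : insert l ((S.1.erase j).erase l) = S.1.erase j := Finset.insert_erase hl
    rw [e1, e2, sgn_erase, sgn_erase, Finset.erase_right_comm, sgn_erase] at key
    rw [sgn_erase] at key
    simp only [map_zsmul, smul_smul, hc, Finset.erase_right_comm (a := l) (b := j)]
    rw [← add_smul]
    have : sgn S.1 j * sgn (S.1.erase j) l + sgn S.1 l * sgn (S.1.erase l) j = 0 := by
      linarith
    rw [this, zero_smul]
  · rintro ⟨⟨j, hj⟩, ⟨l, hl⟩⟩ _ _ h
    have h1 := congrArg (fun a : Σ j : {j : Fin k // j ∈ S.1}, {l // l ∈ S.1.erase j.1} => a.1.1) h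
    exact Finset.ne_of_mem_erase hl h1
  · intros; exact Finset.mem_sigma.mpr ⟨Finset.mem_univ _, Finset.mem_univ _⟩
  · intros; rfl

end Koszul

section WeaklyProregular

variable {R : Type u} [CommRing R] {k : ℕ}

/-- Multiplication by the elements of a sequence, as a family of endomorphisms of `M`. -/
def mulEnd (x : Fin k → R) (M : Type u) [AddCommGroup M] [Module R M] (j : Fin k) :
    Module.End R M :=
  LinearMap.lsmul R M (x j)

lemma mulEnd_commute (x : Fin k → R) (M : Type u) [AddCommGroup M] [Module R M] (i j : Fin k) :
    Commute (mulEnd x M i) (mulEnd x M j) := by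
  ext m
  simp [mulEnd, smul_comm (x i)]

/-- The Koszul complex `K_•(x; M)`. -/
def koszulComplex (x : Fin k → R) (M : Type u) [AddCommGroup M] [Module R M] :
    ChainComplex (ModuleCat.{u} R) ℕ :=
  ChainComplex.of (fun p => ModuleCat.of R (KoszulTerm k M p))
    (fun p => ModuleCat.ofHom (koszulBoundary (mulEnd x M) p))
    (fun p => by
      rw [← ModuleCat.ofHom_comp, koszulBoundary_comp _ (mulEnd_commute x M)]
      rfl)

/-- The degree `p` component of `K_•(x^(m); M) → K_•(x^(n); M)` for `n ≤ m`; it sends `e_S` to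
`(∏_{j ∈ S} x_j^(m - n)) e_S`. -/
def koszulPowHom (x : Fin k → R) (M : Type u) [AddCommGroup M] [Module R M] (m n p : ℕ) :
    KoszulTerm k M p →ₗ[R] KoszulTerm k M p :=
  LinearMap.pi fun S => (∏ j ∈ S.1, x j ^ (m - n)) • LinearMap.proj S

/-- The natural map `K_•(x^(m); M) → K_•(x^(n); M)` for `n ≤ m`, where
`x^(n) = x_1^n, …, x_k^n`. It is the tensor product over `j` of the maps
`K_•(x_j^m) → K_•(x_j^n)` given by the identity in degree `0` and by `x_j^(m - n)` in
degree `1`. -/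
def koszulPowMap (x : Fin k → R) (M : Type u) [AddCommGroup M] [Module R M] {n m : ℕ}
    (h : n ≤ m) :
    koszulComplex (fun j => x j ^ m) M ⟶ koszulComplex (fun j => x j ^ n) M :=
  ChainComplex.ofHom (fun p => ModuleCat.ofHom (koszulPowHom x M m n p)) (by
    intro p
    simp only [koszulComplex, ChainComplex.of, ChainComplex.of_d]
    rw [← ModuleCat.ofHom_comp, ← ModuleCat.ofHom_comp]
    congr 1
    refine LinearMap.ext fun f => ?_
    funext S
    simp only [koszulPowHom, koszulBoundary, mulEnd, LinearMap.comp_apply, LinearMap.coe_mk,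
      AddHom.coe_mk, LinearMap.pi_apply, LinearMap.smul_apply, LinearMap.proj_apply,
      LinearMap.lsmul_apply, Finset.smul_sum]
    refine Finset.sum_congr rfl fun j _ => ?_
    rw [Finset.prod_insert j.2, smul_comm _ (sgn S.1 j.1), smul_smul, smul_smul]
    congr 2
    rw [← mul_assoc, ← pow_add, Nat.add_sub_cancel' h, mul_comm])

/-- The sequence `x` is `M`-weakly proregular: for all `i > 0` and `n > 0` there is `m ≥ n` such
that the natural map `H_i(x^(m); M) → H_i(x^(n); M)` is zero. -/
def IsWeaklyProregularOn (x : Fin k → R) (M : Type u) [AddCommGroup M] [Module R M] : Prop :=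
  ∀ i : ℕ, 0 < i → ∀ n : ℕ, 0 < n → ∃ (m : ℕ) (h : n ≤ m),
    HomologicalComplex.homologyMap (koszulPowMap x M h) i = 0

/-- The sequence `x` in `R` is weakly proregular if it is `R`-weakly proregular. -/
def IsWeaklyProregular (x : Fin k → R) : Prop :=
  IsWeaklyProregularOn x R

end WeaklyProregular

section Cech

variable {R : Type u} [CommRing R] {k : ℕ}

/-- For one element `x` the Čech complex `R → R_x` (in degrees `0` and `1`) has the free
resolution `R ⊕ R[T] → R[T]`, `(r, f) ↦ r + (1 - x T) f`. Label the basis of its degree `0` part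
as `e_0 = (1, 0)`, `e_{n+1} = (0, T^n)` and that of its degree `1` part as `f_n = T^n`: the
differential is `e_0 ↦ f_0` and `e_{n+1} ↦ f_n - x f_{n+1}`, and the quasi-isomorphism to
`R → R_x` is `e_0 ↦ 1`, `e_{n+1} ↦ 0`, `f_n ↦ 1 / x^n`.

For a sequence of `k` elements one takes the tensor product of these `k` complexes. All its terms
are direct sums of copies of the free module on `ℕ^k`; this is the differential of the `j`-th
tensor factor. -/
def cechEnd (x : Fin k → R) (j : Fin k) : Module.End R ((Fin k → ℕ) →₀ R) :=
  Finsupp.linearCombination R fun a =>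
    if a j = 0 then Finsupp.single a 1
    else Finsupp.single (Function.update a j (a j - 1)) 1 - x j • Finsupp.single a 1

lemma cechEnd_single (x : Fin k → R) (j : Fin k) (a : Fin k → ℕ) :
    cechEnd x j (Finsupp.single a 1) =
      if a j = 0 then Finsupp.single a 1
      else Finsupp.single (Function.update a j (a j - 1)) 1 - x j • Finsupp.single a 1 := by
  simp [cechEnd]

lemma cechEnd_commute (x : Fin k → R) (i j : Fin k) :
    Commute (cechEnd x i) (cechEnd x j) := by
  rcases eq_or_ne i j with rfl | hij
  · exact Commute.refl _
  refine Finsupp.lhom_ext' fun a => LinearMap.ext_ring ?_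
  simp only [LinearMap.comp_apply, Finsupp.lsingle_apply, Module.End.mul_apply, cechEnd_single]
  by_cases hi : a i = 0 <;> by_cases hj : a j = 0 <;>
    simp only [hi, hj, if_true, if_false, map_sub, map_smul, cechEnd_single, ne_eq, hij,
      hij.symm, not_false_eq_true, Function.update_of_ne]
  rw [Function.update_comm hij]
  simp only [smul_sub, smul_comm (x i) (x j)]
  abel

/-- The bounded free resolution of the Čech complex of `x = x_1, …, x_k`: the tensor product over
`j` of the complexes `R ⊕ R[T_j] → R[T_j]`, in cohomological degrees `0, …, k`. -/
def cechResolution (x : Fin k → R) : CochainComplex (ModuleCat.{u} R) ℕ :=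
  CochainComplex.of (fun p => ModuleCat.of R (KoszulTerm k ((Fin k → ℕ) →₀ R) p))
    (fun p => ModuleCat.ofHom (koszulCoboundary (cechEnd x) p))
    (fun p => by
      rw [← ModuleCat.ofHom_comp, koszulCoboundary_comp _ (cechEnd_commute x)]
      rfl)

/-- The complex `Hom_R(L, M)`, with `Hom_R(L^i, M)` in homological degree `i`. -/
def homComplex (L : CochainComplex (ModuleCat.{u} R) ℕ) (M : Type u) [AddCommGroup M]
    [Module R M] : ChainComplex (ModuleCat.{u} R) ℕ :=
  ChainComplex.of (fun i => ModuleCat.of R (L.X i →ₗ[R] M))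
    (fun i => ModuleCat.ofHom (LinearMap.lcomp R M (L.d i (i + 1)).hom))
    (fun i => by
      rw [← ModuleCat.ofHom_comp]
      ext f y
      have h := congrArg (fun g => g.hom y) (L.d_comp_d i (i + 1) (i + 1 + 1))
      simp only [ModuleCat.hom_comp, LinearMap.comp_apply] at h
      simp [h])

/-- Čech homology `H_i(Hom_R(L_x, M))` of `M` with respect to `x`, where `L_x` is the free
resolution of the Čech complex of `x`. -/
def cechHomology (x : Fin k → R) (M : Type u) [AddCommGroup M] [Module R M] (i : ℕ) :
    ModuleCat.{u} R :=
  (homComplex (cechResolution x) M).homology i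

end Cech

end CechKoszul

end

/-! Tensor-hom adjunction gives `Hom(L_x, Hom(I, J)) = Hom(L_x ⊗ I, J)`. For injective `J` this
functor preserves exactness, and a cogenerator detects it. So (ii) and (iii) both say that `L_x ⊗ I`
is exact in positive degrees for every injective `I` (`CechExact`, `CechExact.isZero_cechHomology`,
`cechExact_of_isZero_cechHomology`).

The complex `L_x ⊗ I` is a tensor product of telescopes. It is the increasing union of its boxes, on
which all exponents are at most `n`. Each box retracts up to homotopy onto the Koszul cochain
complex of `x^(n)` with coefficients in `I`; enlarging the box from `n` to `m` induces
multiplication by `∏_{j ∈ S} x_j^(m - n)` at `e_S`. Hence `L_x ⊗ I` is exact in a positive degree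
iff every Koszul cocycle for `x^(n)` becomes a coboundary for some `x^(m)` (`cechExact_of_koszul`,
`CechExact.koszul`).

That Koszul cochain complex is `Hom(K_•(x^(n)), I)`. Injectivity of `I` turns a zero map on Koszul
homology into a zero map on cohomology (`IsWeaklyProregular.cechExact`). Conversely, embed chains
modulo boundaries into an injective module: the exponent `m` that kills this one universal cocycle
works for all cycles at once (`isWeaklyProregular_of_cechExact`). -/

namespace CechKoszul

/-! ### Cochain maps and contracting homotopies between Koszul-type complexes. -/

section Cube

variable {R : Type u} [CommRing R] {k : ℕ}
  {N : Type u} [AddCommGroup N] [Module R N] {N' : Type u} [AddCommGroup N'] [Module R N']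

/-- The map on Koszul terms given by a linear map in each direction `S`. -/
def cubeMap (T : Finset (Fin k) → N →ₗ[R] N') (p : ℕ) :
    KoszulTerm k N p →ₗ[R] KoszulTerm k N' p :=
  LinearMap.pi fun S => T S.1 ∘ₗ LinearMap.proj S

@[simp]
lemma cubeMap_apply (T : Finset (Fin k) → N →ₗ[R] N') (p : ℕ) (c : KoszulTerm k N p)
    (S : {S : Finset (Fin k) // S.card = p}) : cubeMap T p c S = T S.1 (c S) :=
  rfl

/-- The submodule `W` is needed for `boxEval`, which commutes with the differentials only on a box.
-/
lemma cubeMap_koszulCoboundary {φ : Fin k → Module.End R N} {φ' : Fin k → Module.End R N'}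
    {T : Finset (Fin k) → N →ₗ[R] N'} (W : Submodule R N)
    (hT : ∀ (S : Finset (Fin k)), ∀ j ∈ S, ∀ n ∈ W, T S (φ j n) = φ' j (T (S.erase j) n))
    {p : ℕ} {c : KoszulTerm k N p} (hc : ∀ S, c S ∈ W) :
    cubeMap T (p + 1) (koszulCoboundary φ p c) = koszulCoboundary φ' p (cubeMap T p c) := by
  funext S
  simp only [koszulCoboundary, cubeMap_apply, LinearMap.coe_mk, AddHom.coe_mk, map_sum, map_zsmul]
  exact Finset.sum_congr rfl fun j _ => by rw [hT S.1 j.1 j.2 _ (hc _)]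

lemma sgn_mul_self (S : Finset (Fin k)) (j : Fin k) : sgn S j * sgn S j = 1 := by
  simp [sgn, ← mul_pow]

/-- The contraction of Koszul terms with the `j`-th basis vector, twisted by an endomorphism. -/
def contraction (j : Fin k) (ψ : Module.End R N) (p : ℕ) :
    KoszulTerm k N (p + 1) →ₗ[R] KoszulTerm k N p :=
  LinearMap.pi fun S => if h : j ∈ S.1 then 0 else
    sgn S.1 j • ψ ∘ₗ (LinearMap.proj ⟨insert j S.1, by
      rw [Finset.card_insert_of_notMem h, S.2]⟩ : KoszulTerm k N (p + 1) →ₗ[R] N)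

lemma contraction_of_mem {j : Fin k} (ψ : Module.End R N) {p : ℕ} (c : KoszulTerm k N (p + 1))
    {S : {S : Finset (Fin k) // S.card = p}} (h : j ∈ S.1) : contraction j ψ p c S = 0 := by
  simp [contraction, h]

lemma contraction_of_notMem {j : Fin k} (ψ : Module.End R N) {p : ℕ} (c : KoszulTerm k N (p + 1))
    {S : {S : Finset (Fin k) // S.card = p}} (h : j ∉ S.1) : contraction j ψ p c S =
      sgn S.1 j • ψ (c ⟨insert j S.1, by rw [Finset.card_insert_of_notMem h, S.2]⟩) := by
  simp [contraction, h]

/-- Extension of a function on the `p`-element subsets by zero. -/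
def extend {p : ℕ} (c : KoszulTerm k N p) (S : Finset (Fin k)) : N :=
  if h : S.card = p then c ⟨S, h⟩ else 0

lemma extend_coe {p : ℕ} (c : KoszulTerm k N p) (S : {S : Finset (Fin k) // S.card = p}) :
    extend c S.1 = c S := by
  rw [extend, dif_pos S.2]

lemma koszulCoboundary_apply (φ : Fin k → Module.End R N) {p : ℕ} (c : KoszulTerm k N p)
    (S : {S : Finset (Fin k) // S.card = p + 1}) :
    koszulCoboundary φ p c S = ∑ j ∈ S.1, sgn S.1 j • φ j (extend c (S.1.erase j)) := by
  rw [← Finset.sum_coe_sort]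
  refine Finset.sum_congr rfl fun j _ => ?_
  have h : (S.1.erase j.1).card = p := by rw [Finset.card_erase_of_mem j.2, S.2]; rfl
  rw [extend, dif_pos h]

lemma koszulBoundary_apply (φ : Fin k → Module.End R N) {p : ℕ} (c : KoszulTerm k N (p + 1))
    (S : {S : Finset (Fin k) // S.card = p}) :
    koszulBoundary φ p c S = ∑ j ∈ S.1ᶜ, sgn S.1 j • φ j (extend c (insert j S.1)) := by
  rw [Finset.sum_subtype (p := fun j => j ∉ S.1) _ (by simp)]
  simp only [koszulBoundary, LinearMap.coe_mk, AddHom.coe_mk]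
  refine Finset.sum_congr rfl fun j _ => ?_
  have h : (insert j.1 S.1).card = p + 1 := by rw [Finset.card_insert_of_notMem j.2, S.2]
  rw [extend, dif_pos h]

/-- Cartan's formula: contraction with `e_j` anticommutes with the wedge by `e_i` for `i ≠ j`, so
only the `j`-th differential survives. It acts after `ψ` at `S` containing `j`, and before `ψ`
elsewhere. -/
lemma koszulCoboundary_contraction_add {φ : Fin k → Module.End R N} {j : Fin k}
    {ψ : Module.End R N} (hψ : ∀ i, i ≠ j → Commute (φ i) ψ) {p : ℕ}
    (c : KoszulTerm k N (p + 1)) :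
    koszulCoboundary φ p (contraction j ψ p c) +
        contraction j ψ (p + 1) (koszulCoboundary φ (p + 1) c) =
      cubeMap (fun S => if j ∈ S then φ j * ψ else ψ * φ j) (p + 1) c := by
  funext S
  have hcard : ∀ i ∈ S.1, (S.1.erase i).card = p := fun i hi => by
    rw [Finset.card_erase_of_mem hi, S.2]; rfl
  by_cases hj : j ∈ S.1
  · rw [Pi.add_apply, contraction_of_mem _ _ hj, add_zero, koszulCoboundary_apply,
      Finset.sum_eq_single_of_mem j hj]
    · have hj' : j ∉ S.1.erase j := by simp
      rw [extend, dif_pos (hcard j hj), contraction_of_notMem _ _ hj']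
      simp only [sgn_erase, map_zsmul, smul_smul, sgn_mul_self, one_smul, cubeMap_apply, hj,
        if_true, Module.End.mul_apply, Finset.insert_erase hj]
    · intro i hi hij
      rw [extend, dif_pos (hcard i hi), contraction_of_mem]
      · simp
      · exact Finset.mem_erase.mpr ⟨hij.symm, hj⟩
  · have e0 : extend c S.1 = c S := extend_coe c S
    rw [Pi.add_apply, contraction_of_notMem _ _ hj, koszulCoboundary_apply, koszulCoboundary_apply,
      Finset.sum_insert hj, Finset.erase_insert hj, e0, map_add, smul_add, map_zsmul, smul_smul]
    have e1 : sgn S.1 j * sgn (insert j S.1) j = 1 := by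
      rw [← sgn_erase (insert j S.1), Finset.erase_insert hj, sgn_mul_self]
    rw [e1, one_smul, map_sum, Finset.smul_sum, add_left_comm, ← Finset.sum_add_distrib,
      Finset.sum_eq_zero, add_zero]
    · simp [hj]
    · intro i hi
      have hij : i ≠ j := fun h => hj (h ▸ hi)
      have hj' : j ∉ S.1.erase i := fun h => hj (Finset.mem_of_mem_erase h)
      have e2 : (insert j S.1).erase i = insert j (S.1.erase i) :=
        Finset.erase_insert_of_ne hij.symm
      have h1 : (insert j (S.1.erase i)).card = p + 1 := by
        rw [Finset.card_insert_of_notMem hj', hcard i hi]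
      rw [extend, dif_pos (hcard i hi), contraction_of_notMem _ _ hj']
      simp only [e2, extend, dif_pos h1, map_zsmul, smul_smul]
      rw [show ψ (φ i _) = φ i (ψ _) from (LinearMap.congr_fun (hψ i hij) _).symm, ← add_smul]
      have key := sgn_mul_sgn_insert (S := S.1.erase i) (j := i) (l := j) (by simp) hj' hij
      rw [Finset.insert_erase hi, sgn_erase, ← e2, sgn_erase] at key
      have hB := sgn_mul_self S.1 j
      have hC := sgn_mul_self (S.1.erase i) j
      -- Multiply the exchange identity by `sgn S j * sgn (S.erase i) j`; signs square to one.
      rw [show sgn S.1 i * sgn (S.1.erase i) j + sgn S.1 j * sgn (insert j S.1) i = 0 by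
        linear_combination sgn S.1 j * sgn (S.1.erase i) j * key -
          sgn S.1 i * sgn (S.1.erase i) j * hB - sgn S.1 j * sgn (insert j S.1) i * hC, zero_smul]

end Cube

/-! ### Vanishing of homology in terms of elements. -/

section Homology

variable {R : Type u} [CommRing R]

lemma homologyπ_eq_zero_iff (L : ChainComplex (ModuleCat.{u} R) ℕ) (q : ℕ) (w : L.cycles (q + 1)) :
    L.homologyπ (q + 1) w = 0 ↔ ∃ y, L.d (q + 2) (q + 1) y = L.iCycles (q + 1) w := by
  have hex := ShortComplex.exact_of_g_is_cokernel
    (ShortComplex.mk _ _ (L.toCycles_comp_homologyπ (q + 2) (q + 1)))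
    (L.homologyIsCokernel (q + 2) (q + 1) (by simp))
  rw [ShortComplex.moduleCat_exact_iff] at hex
  have hi : Function.Injective (L.iCycles (q + 1)) :=
    (ModuleCat.mono_iff_injective _).mp inferInstance
  constructor
  · intro h
    obtain ⟨y, hy⟩ := hex w h
    refine ⟨y, ?_⟩
    rw [← L.toCycles_i, ModuleCat.comp_apply]
    exact congrArg _ hy
  · rintro ⟨y, hy⟩
    have : w = L.toCycles (q + 2) (q + 1) y := hi (by
      rw [← ModuleCat.comp_apply, L.toCycles_i, hy])
    rw [this, ← ModuleCat.comp_apply, L.toCycles_comp_homologyπ]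
    rfl

/-- Since `homologyπ` is epi, vanishing can be tested on cycles, whose image must then be a
boundary. -/
lemma homologyMap_eq_zero_iff {K L : ChainComplex (ModuleCat.{u} R) ℕ} (φ : K ⟶ L) (q : ℕ) :
    HomologicalComplex.homologyMap φ (q + 1) = 0 ↔
      ∀ z, K.d (q + 1) q z = 0 → ∃ y, L.d (q + 2) (q + 1) y = φ.f (q + 1) z := by
  have h1 : HomologicalComplex.homologyMap φ (q + 1) = 0 ↔
      ∀ w, L.homologyπ (q + 1) (HomologicalComplex.cyclesMap φ (q + 1) w) = 0 := by
    rw [← cancel_epi (K.homologyπ (q + 1)), HomologicalComplex.homologyπ_naturality,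
      Limits.comp_zero]
    refine ⟨fun h w => ?_, fun h => ?_⟩
    · rw [← ModuleCat.comp_apply, h]; rfl
    · ext w; exact h w
  rw [h1]
  constructor
  · intro h z hz
    -- An element killed by `d` is lifted to the abstract cycles object as a morphism out of `R`.
    let f : ModuleCat.of R R ⟶ K.X (q + 1) := ModuleCat.ofHom (LinearMap.toSpanSingleton R _ z)
    have hf : f ≫ K.d (q + 1) q = 0 := by
      ext
      simpa [f] using hz
    obtain ⟨y, hy⟩ := (homologyπ_eq_zero_iff L q _).mp
      (h (K.liftCycles f q (by simp) hf (1 : R)))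
    refine ⟨y, hy.trans ?_⟩
    rw [← ModuleCat.comp_apply, HomologicalComplex.cyclesMap_i, ← ModuleCat.comp_apply,
      HomologicalComplex.liftCycles_i_assoc]
    simp [f]
  · intro h w
    obtain ⟨y, hy⟩ := h (K.iCycles (q + 1) w) (by
      rw [← ModuleCat.comp_apply, K.iCycles_d]; rfl)
    refine (homologyπ_eq_zero_iff L q _).mpr ⟨y, hy.trans ?_⟩
    rw [← ModuleCat.comp_apply, ← ModuleCat.comp_apply, HomologicalComplex.cyclesMap_i]

lemma isZero_homology_iff (K : ChainComplex (ModuleCat.{u} R) ℕ) (q : ℕ) :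
    Limits.IsZero (K.homology (q + 1)) ↔
      ∀ z, K.d (q + 1) q z = 0 → ∃ y, K.d (q + 2) (q + 1) y = z := by
  rw [← K.exactAt_iff_isZero_homology, K.exactAt_iff' (q + 2) (q + 1) q (by simp) (by simp),
    ShortComplex.moduleCat_exact_iff]
  rfl

variable {k : ℕ}

lemma isWeaklyProregular_iff (x : Fin k → R) :
    IsWeaklyProregular x ↔ ∀ q n : ℕ, 0 < n → ∃ m, n ≤ m ∧
      ∀ z : KoszulTerm k R (q + 1), koszulBoundary (mulEnd (fun j => x j ^ m) R) q z = 0 →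
        ∃ y, koszulBoundary (mulEnd (fun j => x j ^ n) R) (q + 1) y =
          koszulPowHom x R m n (q + 1) z := by
  have key (q n m : ℕ) (h : n ≤ m) :
      HomologicalComplex.homologyMap (koszulPowMap x R h) (q + 1) = 0 ↔
      ∀ z : KoszulTerm k R (q + 1), koszulBoundary (mulEnd (fun j => x j ^ m) R) q z = 0 →
        ∃ y, koszulBoundary (mulEnd (fun j => x j ^ n) R) (q + 1) y =
          koszulPowHom x R m n (q + 1) z := by
    have hd (n p : ℕ) : (koszulComplex (fun j => x j ^ n) R).d (p + 1) p =
        ModuleCat.ofHom (koszulBoundary (mulEnd (fun j => x j ^ n) R) p) := by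
      simp only [koszulComplex, ChainComplex.of_d]
    rw [homologyMap_eq_zero_iff, hd, hd]
    rfl
  constructor
  · intro H q n hn
    obtain ⟨m, h, hm⟩ := H (q + 1) q.succ_pos n hn
    exact ⟨m, h, (key q n m h).mp hm⟩
  · rintro H (_ | q) hi n hn
    · exact absurd hi (lt_irrefl 0)
    · obtain ⟨m, h, hm⟩ := H q n hn
      exact ⟨m, h, (key q n m h).mpr hm⟩

lemma isZero_cechHomology_iff (x : Fin k → R) (M : Type u) [AddCommGroup M] [Module R M]
    (q : ℕ) :
    Limits.IsZero (cechHomology x M (q + 1)) ↔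
      ∀ g : KoszulTerm k ((Fin k → ℕ) →₀ R) (q + 1) →ₗ[R] M,
        g ∘ₗ koszulCoboundary (cechEnd x) q = 0 →
        ∃ g' : KoszulTerm k ((Fin k → ℕ) →₀ R) (q + 2) →ₗ[R] M,
          g' ∘ₗ koszulCoboundary (cechEnd x) (q + 1) = g := by
  rw [cechHomology, isZero_homology_iff]
  have hd (p : ℕ) : (cechResolution x).d p (p + 1) =
      ModuleCat.ofHom (koszulCoboundary (cechEnd x) p) := by
    simp only [cechResolution, CochainComplex.of_d]
  have hd' (p : ℕ) : (homComplex (cechResolution x) M).d (p + 1) p =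
      ModuleCat.ofHom (LinearMap.lcomp R M (koszulCoboundary (cechEnd x) p)) := by
    simp only [homComplex, ChainComplex.of_d, hd]
    rfl
  rw [hd', hd']
  rfl

end Homology

/-! ### Operators on single tensor factors, and boxes of bounded exponents. -/

section Coordinate

variable {R : Type u} [CommRing R] {k : ℕ} (I : Type u) [AddCommGroup I] [Module R I]

/-- The map `q ⊗ v ↦ ∑ t, q t • v e_b`, with `b` obtained from `a` by replacing `a j` by `t`. -/
noncomputable def coordInsert (j : Fin k) (a : Fin k → ℕ) :
    (ℕ →₀ R) →ₗ[R] I →ₗ[R] ((Fin k → ℕ) →₀ I) :=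
  Finsupp.linearCombination R fun t => Finsupp.lsingle (Function.update a j t)

/-- An endomorphism of the free module on `ℕ` acting on the `j`-th tensor factor. -/
noncomputable def coordEnd (j : Fin k) (A : Module.End R (ℕ →₀ R)) :
    Module.End R ((Fin k → ℕ) →₀ I) :=
  Finsupp.lsum R fun a => coordInsert I j a (A (Finsupp.single (a j) 1))

variable {I}

@[simp]
lemma coordInsert_single (j : Fin k) (a : Fin k → ℕ) (t : ℕ) (r : R) (v : I) :
    coordInsert I j a (Finsupp.single t r) v = r • Finsupp.single (Function.update a j t) v := by
  simp [coordInsert]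

lemma coordEnd_single (j : Fin k) (A : Module.End R (ℕ →₀ R)) (a : Fin k → ℕ) (v : I) :
    coordEnd I j A (Finsupp.single a v) = coordInsert I j a (A (Finsupp.single (a j) 1)) v := by
  simp [coordEnd]

lemma coordInsert_update (j : Fin k) (a : Fin k → ℕ) (t : ℕ) :
    coordInsert (R := R) I j (Function.update a j t) = coordInsert I j a := by
  refine Finsupp.lhom_ext' fun s => LinearMap.ext_ring ?_
  ext v : 1
  simp

lemma coordEnd_coordInsert (j : Fin k) (A : Module.End R (ℕ →₀ R)) (a : Fin k → ℕ)
    (q : ℕ →₀ R) (v : I) : coordEnd I j A (coordInsert I j a q v) = coordInsert I j a (A q) v := by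
  induction q using Finsupp.induction_linear with
  | zero => simp
  | add f g hf hg => simp [hf, hg]
  | single t r =>
    rw [coordInsert_single, map_smul, coordEnd_single, coordInsert_update, Function.update_self,
      ← LinearMap.smul_apply, ← map_smul, ← map_smul, Finsupp.smul_single, smul_eq_mul, mul_one]

lemma coordEnd_mul (j : Fin k) (A B : Module.End R (ℕ →₀ R)) :
    coordEnd I j (A * B) = coordEnd I j A * coordEnd I j B := by
  refine Finsupp.lhom_ext fun a v => ?_
  rw [Module.End.mul_apply, coordEnd_single, coordEnd_single, coordEnd_coordInsert]
  rfl

lemma coordEnd_one (j : Fin k) : coordEnd (R := R) I j 1 = 1 := by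
  refine Finsupp.lhom_ext fun a v => ?_
  simp [coordEnd_single]

lemma coordEnd_sub (j : Fin k) (A B : Module.End R (ℕ →₀ R)) :
    coordEnd I j (A - B) = coordEnd I j A - coordEnd I j B := by
  refine Finsupp.lhom_ext fun a v => ?_
  simp [coordEnd_single]

/-- Expands the action on factor `i` while factor `j` holds an arbitrary vector `p`; this is the
form needed for `coordEnd_commute`. -/
lemma coordEnd_coordInsert_of_ne {i j : Fin k} (hij : i ≠ j) (A : Module.End R (ℕ →₀ R))
    (a : Fin k → ℕ) (p : ℕ →₀ R) (v : I) :
    coordEnd I i A (coordInsert I j a p v) =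
      (Finsupp.linearCombination R fun s => coordInsert I j (Function.update a i s) p)
        (A (Finsupp.single (a i) 1)) v := by
  induction p using Finsupp.induction_linear with
  | zero => simp [Finsupp.linearCombination_apply]
  | add f g hf hg =>
    simp only [map_add, LinearMap.add_apply, hf, hg, Finsupp.linearCombination_apply, smul_add,
      Finsupp.sum_add]
  | single t r =>
    rw [coordInsert_single, map_smul, coordEnd_single, Function.update_of_ne hij]
    generalize A (Finsupp.single (a i) 1) = q
    induction q using Finsupp.induction_linear with
    | zero => simp
    | add f g hf hg => simp [hf, hg]
    | single s r' =>
      simp [smul_comm r, Function.update_comm hij]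

lemma coordEnd_commute {i j : Fin k} (hij : i ≠ j) (A B : Module.End R (ℕ →₀ R)) :
    Commute (coordEnd I i A) (coordEnd I j B) := by
  refine Finsupp.lhom_ext fun a v => ?_
  rw [Module.End.mul_apply, Module.End.mul_apply, coordEnd_single, coordEnd_single,
    coordEnd_coordInsert_of_ne hij A]
  generalize A (Finsupp.single (a i) 1) = q
  induction q using Finsupp.induction_linear with
  | zero => simp
  | add f g hf hg => simp [hf, hg]
  | single s r =>
    simp [coordEnd_single, Function.update_of_ne hij.symm]

lemma mapRange_coordEnd {I' : Type u} [AddCommGroup I'] [Module R I'] (f : I →ₗ[R] I')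
    (j : Fin k) (A : Module.End R (ℕ →₀ R)) (z : (Fin k → ℕ) →₀ I) :
    Finsupp.mapRange.linearMap f (coordEnd I j A z) =
      coordEnd I' j A (Finsupp.mapRange.linearMap f z) := by
  suffices h : Finsupp.mapRange.linearMap f ∘ₗ coordEnd I j A =
      coordEnd I' j A ∘ₗ Finsupp.mapRange.linearMap f from LinearMap.congr_fun h z
  refine Finsupp.lhom_ext fun a v => ?_
  simp only [LinearMap.comp_apply, coordEnd_single, Finsupp.mapRange.linearMap_apply,
    Finsupp.mapRange_single]
  generalize A (Finsupp.single (a j) 1) = q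
  induction q using Finsupp.induction_linear with
  | zero => simp
  | add p q hp hq => simp [Finsupp.mapRange_add, hp, hq]
  | single s r => simp

/-- The tensor product of linear functionals on the free module on `ℕ`, with values in `I`. -/
noncomputable def coordEval (I : Type u) [AddCommGroup I] [Module R I]
    (l : Fin k → (ℕ →₀ R) →ₗ[R] R) : ((Fin k → ℕ) →₀ I) →ₗ[R] I :=
  Finsupp.lsum R fun a => (∏ j, l j (Finsupp.single (a j) 1)) • LinearMap.id

lemma coordEval_single (l : Fin k → (ℕ →₀ R) →ₗ[R] R) (a : Fin k → ℕ) (v : I) :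
    coordEval I l (Finsupp.single a v) = (∏ j, l j (Finsupp.single (a j) 1)) • v := by
  simp [coordEval]

lemma coordEval_coordEnd_single (l : Fin k → (ℕ →₀ R) →ₗ[R] R) (j : Fin k)
    (A : Module.End R (ℕ →₀ R)) (a : Fin k → ℕ) (v : I) :
    coordEval I l (coordEnd I j A (Finsupp.single a v)) =
      (l j (A (Finsupp.single (a j) 1)) *
        ∏ i ∈ Finset.univ.erase j, l i (Finsupp.single (a i) 1)) • v := by
  rw [coordEnd_single]
  generalize A (Finsupp.single (a j) 1) = q
  induction q using Finsupp.induction_linear with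
  | zero => simp
  | add p q hp hq => simp [hp, hq, add_mul, add_smul]
  | single s r =>
    rw [coordInsert_single, map_smul, coordEval_single,
      ← Finset.mul_prod_erase _ _ (Finset.mem_univ j), smul_smul, ← mul_assoc, Function.update_self,
      ← smul_eq_mul r, ← map_smul, Finsupp.smul_single, smul_eq_mul, mul_one]
    congr 2
    refine Finset.prod_congr rfl fun i hi => ?_
    rw [Function.update_of_ne (Finset.ne_of_mem_erase hi)]

/-- The elements supported in the box `a j ≤ n`. -/
def box (R : Type u) [CommRing R] (k : ℕ) (I : Type u) [AddCommGroup I] [Module R I] (n : ℕ) :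
    Submodule R ((Fin k → ℕ) →₀ I) :=
  Finsupp.supported I R {a | ∀ j, a j ≤ n}

lemma single_mem_box {n : ℕ} {a : Fin k → ℕ} (ha : ∀ j, a j ≤ n) (v : I) :
    Finsupp.single a v ∈ box R k I n :=
  Finsupp.single_mem_supported R v ha

lemma box_mono {n m : ℕ} (h : n ≤ m) : box R k I n ≤ box R k I m :=
  Finsupp.supported_mono fun _ ha j => (ha j).trans h

lemma eq_of_mem_box {N' : Type u} [AddCommGroup N'] [Module R N']
    {f g : ((Fin k → ℕ) →₀ I) →ₗ[R] N'} {n : ℕ}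
    (h : ∀ (a : Fin k → ℕ) (v : I), (∀ j, a j ≤ n) → f (Finsupp.single a v) = g (Finsupp.single a v))
    {z : (Fin k → ℕ) →₀ I} (hz : z ∈ box R k I n) : f z = g z := by
  rw [← Finsupp.sum_single z, Finsupp.sum, map_sum, map_sum]
  exact Finset.sum_congr rfl fun a ha => h a _ (hz ha)

lemma map_mem_of_mem_box {N' : Type u} [AddCommGroup N'] [Module R N']
    {f : ((Fin k → ℕ) →₀ I) →ₗ[R] N'} {W : Submodule R N'} {n : ℕ}
    (h : ∀ (a : Fin k → ℕ) (v : I), (∀ j, a j ≤ n) → f (Finsupp.single a v) ∈ W)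
    {z : (Fin k → ℕ) →₀ I} (hz : z ∈ box R k I n) : f z ∈ W := by
  rw [← Finsupp.sum_single z, Finsupp.sum, map_sum]
  exact Submodule.sum_mem _ fun a ha => h a _ (hz ha)

lemma coordEnd_mem_box {n : ℕ} (j : Fin k) {A : Module.End R (ℕ →₀ R)}
    (hA : ∀ t ≤ n, A (Finsupp.single t 1) ∈ Finsupp.supported R R {t | t ≤ n})
    {z : (Fin k → ℕ) →₀ I} (hz : z ∈ box R k I n) : coordEnd I j A z ∈ box R k I n := by
  refine map_mem_of_mem_box (fun a v ha => ?_) hz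
  rw [coordEnd_single]
  have hq := hA _ (ha j)
  generalize A (Finsupp.single (a j) 1) = q at hq
  rw [← Finsupp.sum_single q, Finsupp.sum, map_sum, LinearMap.sum_apply]
  refine Submodule.sum_mem _ fun t ht => ?_
  rw [coordInsert_single]
  refine Submodule.smul_mem _ _ (single_mem_box (fun i => ?_) v)
  rcases eq_or_ne i j with rfl | hij
  · rw [Function.update_self]; exact hq ht
  · rw [Function.update_of_ne hij]; exact ha i

lemma exists_mem_box {ι : Type*} [Finite ι] (c : ι → (Fin k → ℕ) →₀ I) (n : ℕ) :
    ∃ m, n ≤ m ∧ ∀ i, c i ∈ box R k I m := by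
  cases nonempty_fintype ι
  -- A crude bound: the sum of all coordinates of all exponents that occur.
  refine ⟨n + ∑ i, ∑ a ∈ (c i).support, ∑ j, a j, Nat.le_add_right _ _, fun i a ha j => ?_⟩
  calc a j ≤ ∑ j, a j := Finset.single_le_sum (fun _ _ => Nat.zero_le _) (Finset.mem_univ j)
    _ ≤ ∑ a ∈ (c i).support, ∑ j, a j :=
      Finset.single_le_sum (f := fun a : Fin k → ℕ => ∑ j, a j) (fun _ _ => Nat.zero_le _) ha
    _ ≤ ∑ i, ∑ a ∈ (c i).support, ∑ j, a j :=
      Finset.single_le_sum (f := fun i => ∑ a ∈ (c i).support, ∑ j, a j)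
        (fun _ _ => Nat.zero_le _) (Finset.mem_univ i)
    _ ≤ _ := Nat.le_add_left _ _

end Coordinate

/-! ### One element: retraction of the finite telescope onto `R → R`, multiplication by `y^n`. -/

section Telescope

variable {R : Type u} [CommRing R]

open Finsupp in
/-- The differential of the telescope of `y`. -/
noncomputable def telescope (y : R) : Module.End R (ℕ →₀ R) :=
  linearCombination R fun t => if t = 0 then single t 1 else single (t - 1) 1 - y • single t 1

/-- The contracting homotopy of the first `n` steps of the telescope of `y`. -/
noncomputable def telescopeHomotopy (y : R) (n : ℕ) : Module.End R (ℕ →₀ R) :=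
  Finsupp.linearCombination R fun t =>
    ∑ s ∈ Finset.range (n - t), y ^ s • Finsupp.single (t + s + 1) 1

lemma telescope_zero (y : R) : telescope y (Finsupp.single 0 1) = Finsupp.single 0 1 := by
  simp [telescope]

lemma telescope_succ (y : R) (t : ℕ) : telescope y (Finsupp.single (t + 1) 1) =
    Finsupp.single t 1 - y • Finsupp.single (t + 1) 1 := by
  simp [telescope]

lemma telescopeHomotopy_single (y : R) (n t : ℕ) :
    telescopeHomotopy y n (Finsupp.single t 1) =
      ∑ s ∈ Finset.range (n - t), y ^ s • Finsupp.single (t + s + 1) 1 := by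
  simp [telescopeHomotopy]

/-- The projection of the telescope onto its `n`-th step: in degree one if `b` holds, otherwise in
degree zero. -/
noncomputable def telescopeProj (y : R) (n : ℕ) (b : Prop) [Decidable b] :
    Module.End R (ℕ →₀ R) :=
  1 - if b then telescope y * telescopeHomotopy y n else telescopeHomotopy y n * telescope y

/-- The functional killing the first `n` steps of the telescope: in degree one if `b` holds,
otherwise in degree zero. -/
noncomputable def telescopeEval (y : R) (n : ℕ) (b : Prop) [Decidable b] : (ℕ →₀ R) →ₗ[R] R :=
  Finsupp.linearCombination R fun t => if b then y ^ (n - t) else if t = 0 then 1 else 0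

lemma telescopeEval_single (y : R) (n : ℕ) (b : Prop) [Decidable b] (t : ℕ) :
    telescopeEval y n b (Finsupp.single t 1) =
      if b then y ^ (n - t) else if t = 0 then 1 else 0 := by
  simp [telescopeEval]

/-- Applying the differential to the homotopy sum gives `∑ (y^s f_{t+s} - y^(s+1) f_{t+s+1})`, which
telescopes to `f_t - y^(n-t) f_n`. -/
lemma telescopeProj_single_of_pos (y : R) {n t : ℕ} (ht : t ≤ n) {b : Prop} [Decidable b]
    (hb : b) : telescopeProj y n b (Finsupp.single t 1) = y ^ (n - t) • Finsupp.single n 1 := by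
  rw [telescopeProj, if_pos hb, LinearMap.sub_apply, Module.End.mul_apply,
    telescopeHomotopy_single, map_sum, sub_eq_iff_eq_add, ← sub_eq_iff_eq_add']
  have := Finset.sum_range_sub' (fun s => y ^ s • Finsupp.single (t + s) (1 : R)) (n - t)
  rw [pow_zero, one_smul, add_zero, Nat.add_sub_cancel' ht] at this
  rw [Module.End.one_apply, ← this]
  refine Finset.sum_congr rfl fun s _ => ?_
  rw [map_smul, telescope_succ, smul_sub, smul_smul, ← pow_succ, add_assoc]

lemma telescopeProj_single_succ (y : R) {n t : ℕ} (ht : t + 1 ≤ n) {b : Prop} [Decidable b]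
    (hb : ¬ b) : telescopeProj y n b (Finsupp.single (t + 1) 1) = 0 := by
  rw [telescopeProj, if_neg hb, LinearMap.sub_apply, Module.End.mul_apply, telescope_succ, map_sub,
    map_smul, telescopeHomotopy_single, telescopeHomotopy_single,
    show n - t = n - (t + 1) + 1 by omega, Finset.sum_range_succ', Finset.smul_sum, pow_zero,
    one_smul, Module.End.one_apply, add_zero]
  rw [sub_eq_zero, eq_comm, add_sub_right_comm, add_eq_right, sub_eq_zero]
  refine Finset.sum_congr rfl fun s _ => ?_
  rw [smul_smul, ← pow_succ', show t + (s + 1) + 1 = t + 1 + s + 1 by omega]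

lemma telescopeProj_single_zero (y : R) (n : ℕ) {b : Prop} [Decidable b]
    (hb : ¬ b) : telescopeProj y n b (Finsupp.single 0 1) =
      Finsupp.single 0 1 - ∑ s ∈ Finset.range n, y ^ s • Finsupp.single (s + 1) 1 := by
  rw [telescopeProj, if_neg hb, LinearMap.sub_apply, Module.End.mul_apply, telescope_zero,
    telescopeHomotopy_single]
  simp

/-- On the first `n` steps the projection has rank one in either degree, with `telescopeEval` as its
coefficient; this is what makes the retract a two-term complex. -/
lemma telescopeProj_single (y : R) {n t : ℕ} (ht : t ≤ n) (b : Prop) [Decidable b] :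
    telescopeProj y n b (Finsupp.single t 1) =
      telescopeEval y n b (Finsupp.single t 1) •
        telescopeProj y n b (Finsupp.single (if b then n else 0) 1) := by
  rw [telescopeEval_single]
  by_cases hb : b
  · simp [hb, telescopeProj_single_of_pos y ht trivial,
      telescopeProj_single_of_pos y le_rfl trivial]
  · cases t with
    | zero => simp [hb]
    | succ t => simp [hb, telescopeProj_single_succ y ht not_false]

lemma telescopeEval_proj (y : R) {n t : ℕ} (ht : t ≤ n) (b : Prop) [Decidable b] :
    telescopeEval y n b (telescopeProj y n b (Finsupp.single t 1)) =
      telescopeEval y n b (Finsupp.single t 1) := by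
  rw [telescopeProj_single y ht b, map_smul, smul_eq_mul]
  suffices h : telescopeEval y n b
      (telescopeProj y n b (Finsupp.single (if b then n else 0) 1)) = 1 by rw [h, mul_one]
  by_cases hb : b
  · simp only [hb, if_true]
    rw [telescopeProj_single_of_pos y le_rfl trivial]
    simp [telescopeEval_single]
  · simp only [hb, if_false]
    rw [telescopeProj_single_zero y n not_false, map_sub, map_sum]
    simp only [map_smul, telescopeEval_single]
    simp

/-- Evaluation is a cochain map to multiplication by `y^n`: `f_0` goes to `y^n`, and `f_t - y
f_{t+1}` cancels as long as `t + 1 ≤ n`. Beyond that the truncated exponent `n - t` breaks the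
cancellation. -/
lemma telescopeEval_telescope (y : R) {n t : ℕ} (ht : t ≤ n) {b b' : Prop} [Decidable b]
    [Decidable b'] (hb : b) (hb' : ¬ b') :
    telescopeEval y n b (telescope y (Finsupp.single t 1)) =
      y ^ n * telescopeEval y n b' (Finsupp.single t 1) := by
  cases t with
  | zero => simp [telescope_zero, telescopeEval_single, hb, hb']
  | succ t =>
    rw [telescope_succ, map_sub, map_smul]
    simp only [telescopeEval_single, hb, hb', if_true, if_false, Nat.succ_ne_zero, mul_zero,
      smul_eq_mul]
    rw [← pow_succ', show n - (t + 1) + 1 = n - t by omega, sub_self]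

lemma telescope_mem_supported (y : R) {n t : ℕ} (ht : t ≤ n) :
    telescope y (Finsupp.single t 1) ∈ Finsupp.supported R R {t | t ≤ n} := by
  cases t with
  | zero => rw [telescope_zero]; exact Finsupp.single_mem_supported _ _ ht
  | succ t =>
    rw [telescope_succ]
    exact Submodule.sub_mem _ (Finsupp.single_mem_supported _ _ (Nat.le_of_succ_le ht))
      (Submodule.smul_mem _ _ (Finsupp.single_mem_supported _ _ ht))

lemma telescopeProj_mem_supported (y : R) {n t : ℕ} (ht : t ≤ n) (b : Prop) [Decidable b] :
    telescopeProj y n b (Finsupp.single t 1) ∈ Finsupp.supported R R {t | t ≤ n} := by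
  by_cases hb : b
  · rw [telescopeProj_single_of_pos y ht hb]
    exact Submodule.smul_mem _ _ (Finsupp.single_mem_supported _ _ (le_refl n))
  · cases t with
    | zero =>
      rw [telescopeProj_single_zero y n hb]
      refine Submodule.sub_mem _ (Finsupp.single_mem_supported _ _ ht)
        (Submodule.sum_mem _ fun s hs => Submodule.smul_mem _ _ ?_)
      exact Finsupp.single_mem_supported _ _ (Finset.mem_range.mp hs)
    | succ t => rw [telescopeProj_single_succ y ht hb]; exact Submodule.zero_mem _

/-- This is `(1 - dh)d = d(1 - hd)`. -/
lemma telescopeProj_mul_telescope (y : R) (n : ℕ) {b b' : Prop} [Decidable b] [Decidable b']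
    (hb : b) (hb' : ¬ b') :
    telescopeProj y n b * telescope y = telescope y * telescopeProj y n b' := by
  rw [telescopeProj, telescopeProj, if_pos hb, if_neg hb']
  refine LinearMap.ext fun z => ?_
  simp

end Telescope

/-! ### Boxes of the Čech resolution against Koszul complexes of powers. -/

section Comparison

variable {R : Type u} [CommRing R] {k : ℕ} (x : Fin k → R)
  (I : Type u) [AddCommGroup I] [Module R I]

/-- The differentials of the tensor product of `I` with the telescopes of the `x j`. -/
noncomputable def cechDiff (j : Fin k) : Module.End R ((Fin k → ℕ) →₀ I) :=
  coordEnd I j (telescope (x j))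

lemma cechEnd_eq_cechDiff (j : Fin k) : cechEnd x j = cechDiff x R j := by
  refine Finsupp.lhom_ext' fun a => LinearMap.ext_ring ?_
  rw [LinearMap.comp_apply, LinearMap.comp_apply, Finsupp.lsingle_apply, cechEnd_single, cechDiff,
    coordEnd_single]
  by_cases h : a j = 0
  · rw [if_pos h, h, telescope_zero, coordInsert_single, ← h, Function.update_eq_self, one_smul]
  · obtain ⟨t, ht⟩ := Nat.exists_eq_succ_of_ne_zero h
    rw [if_neg h, ht, Nat.succ_eq_add_one, telescope_succ, map_sub, map_smul, LinearMap.sub_apply,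
      LinearMap.smul_apply, coordInsert_single, coordInsert_single, ← Nat.succ_eq_add_one t, ← ht,
      Function.update_eq_self, one_smul, one_smul, ht, Nat.succ_sub_one]

/-- The map to the Koszul complex of `x^(n)`, a map of complexes on the box of size `n`. -/
noncomputable def boxEval (n : ℕ) (S : Finset (Fin k)) : ((Fin k → ℕ) →₀ I) →ₗ[R] I :=
  coordEval I fun j => telescopeEval (x j) n (j ∈ S)

/-- The projection onto the `n`-th step of the telescope in the direction `j`. -/
noncomputable def stepProj (n : ℕ) (j : Fin k) (S : Finset (Fin k)) :
    Module.End R ((Fin k → ℕ) →₀ I) :=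
  coordEnd I j (telescopeProj (x j) n (j ∈ S))

/-- The composition of the projections `stepProj` in the directions of a list. -/
noncomputable def listProj (n : ℕ) (l : List (Fin k)) (S : Finset (Fin k)) :
    Module.End R ((Fin k → ℕ) →₀ I) :=
  (l.map fun j => stepProj x I n j S).prod

/-- The corner of the box of size `n` in the direction `S`. -/
def corner (n : ℕ) (S : Finset (Fin k)) (j : Fin k) : ℕ :=
  if j ∈ S then n else 0

/-- The section of `boxEval`. -/
noncomputable def boxSection (n : ℕ) (S : Finset (Fin k)) : I →ₗ[R] ((Fin k → ℕ) →₀ I) :=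
  listProj x I n (List.finRange k) S ∘ₗ Finsupp.lsingle (corner n S)

variable {I}

lemma corner_le (n : ℕ) (S : Finset (Fin k)) (j : Fin k) : corner n S j ≤ n := by
  unfold corner; split_ifs <;> simp

lemma cechDiff_mem_box {n : ℕ} (j : Fin k) {z : (Fin k → ℕ) →₀ I} (hz : z ∈ box R k I n) :
    cechDiff x I j z ∈ box R k I n :=
  coordEnd_mem_box j (fun _ ht => telescope_mem_supported _ ht) hz

lemma boxEval_cechDiff {n : ℕ} {S : Finset (Fin k)} {j : Fin k} (hj : j ∈ S)
    {z : (Fin k → ℕ) →₀ I} (hz : z ∈ box R k I n) :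
    boxEval x I n S (cechDiff x I j z) = x j ^ n • boxEval x I n (S.erase j) z := by
  refine eq_of_mem_box (f := boxEval x I n S ∘ₗ cechDiff x I j)
    (g := x j ^ n • boxEval x I n (S.erase j)) (fun a v ha => ?_) hz
  rw [LinearMap.comp_apply, LinearMap.smul_apply, boxEval, cechDiff, coordEval_coordEnd_single,
    boxEval, coordEval_single, ← Finset.mul_prod_erase _ _ (Finset.mem_univ j), smul_smul,
    ← mul_assoc, telescopeEval_telescope (b' := j ∈ S.erase j) _ (ha j) hj (by simp)]
  congr 2
  refine Finset.prod_congr rfl fun i hi => ?_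
  simp [telescopeEval_single, Finset.ne_of_mem_erase hi]

lemma boxEval_stepProj {n : ℕ} (S : Finset (Fin k)) (j : Fin k)
    {z : (Fin k → ℕ) →₀ I} (hz : z ∈ box R k I n) :
    boxEval x I n S (stepProj x I n j S z) = boxEval x I n S z := by
  refine eq_of_mem_box (f := boxEval x I n S ∘ₗ stepProj x I n j S) (fun a v ha => ?_) hz
  rw [LinearMap.comp_apply, boxEval, stepProj, coordEval_coordEnd_single, coordEval_single,
    telescopeEval_proj _ (ha j), Finset.mul_prod_erase _ (fun i =>
      telescopeEval (x i) n (i ∈ S) (Finsupp.single (a i) 1)) (Finset.mem_univ j)]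

/-- In degree one of each factor, `m - a j = (m - n) + (n - a j)`; in degree zero evaluation does
not depend on the box. Box inclusions thus induce the transition maps `koszulPowHom`. -/
lemma boxEval_of_le {n m : ℕ} (h : n ≤ m) (S : Finset (Fin k))
    {z : (Fin k → ℕ) →₀ I} (hz : z ∈ box R k I n) :
    boxEval x I m S z = (∏ j ∈ S, x j ^ (m - n)) • boxEval x I n S z := by
  refine eq_of_mem_box (g := (∏ j ∈ S, x j ^ (m - n)) • boxEval x I n S) (fun a v ha => ?_) hz
  rw [LinearMap.smul_apply, boxEval, boxEval, coordEval_single, coordEval_single, smul_smul,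
    ← Finset.prod_ite_mem_eq S, ← Finset.prod_mul_distrib]
  congr 1
  refine Finset.prod_congr rfl fun j _ => ?_
  by_cases hj : j ∈ S
  · simp only [telescopeEval_single, hj, if_true]
    rw [← pow_add, show m - n + (n - a j) = m - a j by have := ha j; omega]
  · simp [telescopeEval_single, hj]

lemma stepProj_mem_box {n : ℕ} (S : Finset (Fin k)) (j : Fin k)
    {z : (Fin k → ℕ) →₀ I} (hz : z ∈ box R k I n) : stepProj x I n j S z ∈ box R k I n :=
  coordEnd_mem_box j (fun _ ht => telescopeProj_mem_supported _ ht _) hz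

lemma stepProj_cechDiff (n : ℕ) (i : Fin k) {S : Finset (Fin k)} {j : Fin k} (hj : j ∈ S)
    (z : (Fin k → ℕ) →₀ I) :
    stepProj x I n i S (cechDiff x I j z) = cechDiff x I j (stepProj x I n i (S.erase j) z) := by
  rw [stepProj, stepProj, cechDiff, ← Module.End.mul_apply, ← Module.End.mul_apply]
  rcases eq_or_ne i j with rfl | hij
  · rw [← coordEnd_mul, ← coordEnd_mul,
      telescopeProj_mul_telescope (b' := i ∈ S.erase i) _ _ hj (by simp)]
  · rw [(coordEnd_commute hij _ _).eq]
    congr 3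
    simp only [telescopeProj, Finset.mem_erase, ne_eq, hij, not_false_eq_true, true_and]

lemma stepProj_commute (n : ℕ) (S : Finset (Fin k)) (i j : Fin k) :
    Commute (stepProj x I n i S) (stepProj x I n j S) := by
  rcases eq_or_ne i j with rfl | hij
  · exact Commute.refl _
  · exact coordEnd_commute hij _ _

lemma stepProj_single (n : ℕ) (S : Finset (Fin k)) (j : Fin k) {a : Fin k → ℕ}
    (ha : a j ≤ n) (v : I) : stepProj x I n j S (Finsupp.single a v) =
      telescopeEval (x j) n (j ∈ S) (Finsupp.single (a j) 1) •
        stepProj x I n j S (Finsupp.single (Function.update a j (corner n S j)) v) := by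
  rw [stepProj, coordEnd_single, telescopeProj_single _ ha, map_smul, coordEnd_single,
    coordInsert_update, Function.update_self]
  rfl

/-- Contraction twisted by the telescope homotopy is a homotopy from the identity to the projection,
by Cartan's formula. -/
lemma exists_sub_stepProj (n : ℕ) (j : Fin k) {q : ℕ}
    {c : KoszulTerm k ((Fin k → ℕ) →₀ I) (q + 1)}
    (hc : koszulCoboundary (cechDiff x I) (q + 1) c = 0) :
    ∃ b, koszulCoboundary (cechDiff x I) q b = c - cubeMap (stepProj x I n j) (q + 1) c := by
  refine ⟨contraction j (coordEnd I j (telescopeHomotopy (x j) n)) q c, ?_⟩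
  have h := koszulCoboundary_contraction_add (φ := cechDiff x I) (j := j)
    (ψ := coordEnd I j (telescopeHomotopy (x j) n)) (fun i hij => coordEnd_commute hij _ _) c
  rw [hc, map_zero, add_zero] at h
  rw [h]
  funext S
  simp only [Pi.sub_apply, cubeMap_apply, stepProj, telescopeProj, coordEnd_sub, coordEnd_one,
    LinearMap.sub_apply, Module.End.one_apply, sub_sub_cancel]
  by_cases hj : j ∈ S.1 <;> simp [hj, coordEnd_mul, cechDiff]

lemma listProj_cons (n : ℕ) (j : Fin k) (l : List (Fin k)) (S : Finset (Fin k)) :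
    listProj x I n (j :: l) S = stepProj x I n j S * listProj x I n l S := by
  simp [listProj]

lemma listProj_mem_box {n : ℕ} (l : List (Fin k)) (S : Finset (Fin k))
    {z : (Fin k → ℕ) →₀ I} (hz : z ∈ box R k I n) : listProj x I n l S z ∈ box R k I n := by
  induction l with
  | nil => simpa [listProj] using hz
  | cons j l ih => rw [listProj_cons]; exact stepProj_mem_box x S j ih

lemma boxEval_listProj {n : ℕ} (l : List (Fin k)) (S : Finset (Fin k))
    {z : (Fin k → ℕ) →₀ I} (hz : z ∈ box R k I n) :
    boxEval x I n S (listProj x I n l S z) = boxEval x I n S z := by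
  induction l with
  | nil => simp [listProj]
  | cons j l ih =>
    rw [listProj_cons, Module.End.mul_apply, boxEval_stepProj x S j (listProj_mem_box x l S hz), ih]

lemma listProj_cechDiff (n : ℕ) (l : List (Fin k)) {S : Finset (Fin k)} {j : Fin k} (hj : j ∈ S)
    (z : (Fin k → ℕ) →₀ I) :
    listProj x I n l S (cechDiff x I j z) = cechDiff x I j (listProj x I n l (S.erase j) z) := by
  induction l with
  | nil => simp [listProj]
  | cons i l ih =>
    rw [listProj_cons, listProj_cons, Module.End.mul_apply, Module.End.mul_apply, ih,
      stepProj_cechDiff x n i hj]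

/-- The homotopies add up one direction at a time, since each partial projection of a cocycle is
again a cocycle. -/
lemma exists_sub_listProj (n : ℕ) (l : List (Fin k)) {q : ℕ}
    {c : KoszulTerm k ((Fin k → ℕ) →₀ I) (q + 1)}
    (hc : koszulCoboundary (cechDiff x I) (q + 1) c = 0) :
    ∃ b, koszulCoboundary (cechDiff x I) q b = c - cubeMap (listProj x I n l) (q + 1) c := by
  induction l with
  | nil => exact ⟨0, by ext S : 1; simp [listProj]⟩
  | cons j l ih =>
    obtain ⟨b, hb⟩ := ih
    have hc' : koszulCoboundary (cechDiff x I) (q + 1) (cubeMap (listProj x I n l) (q + 1) c) =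
        0 := by
      rw [← cubeMap_koszulCoboundary (φ := cechDiff x I) ⊤
        (fun S j hj z _ => listProj_cechDiff x n l hj z) (fun _ => trivial), hc, map_zero]
    obtain ⟨b', hb'⟩ := exists_sub_stepProj x n j hc'
    refine ⟨b + b', ?_⟩
    rw [map_add, hb, hb', sub_add_sub_cancel]
    congr 1

lemma listProj_single (n : ℕ) (l : List (Fin k)) (S : Finset (Fin k)) {j : Fin k} (hj : j ∈ l)
    {a : Fin k → ℕ} (ha : a j ≤ n) (v : I) : listProj x I n l S (Finsupp.single a v) =
      telescopeEval (x j) n (j ∈ S) (Finsupp.single (a j) 1) •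
        listProj x I n l S (Finsupp.single (Function.update a j (corner n S j)) v) := by
  induction l with
  | nil => simp at hj
  | cons i l ih =>
    rw [listProj_cons]
    by_cases hjl : j ∈ l
    · rw [Module.End.mul_apply, ih hjl, map_smul, Module.End.mul_apply]
    · obtain rfl : j = i := (List.mem_cons.mp hj).resolve_right hjl
      -- Commuting moves the `j`-th projection next to the basis vector, where it can be evaluated.
      have hcomm : Commute (stepProj x I n j S) (listProj x I n l S) :=
        Commute.list_prod_right _ _ fun f hf => by
          obtain ⟨i, -, rfl⟩ := List.mem_map.mp hf
          exact stepProj_commute x n S j i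
      rw [hcomm.eq, Module.End.mul_apply, stepProj_single x n S j ha, map_smul,
        Module.End.mul_apply]

lemma listProj_eq_boxSection {n : ℕ} (S : Finset (Fin k))
    {z : (Fin k → ℕ) →₀ I} (hz : z ∈ box R k I n) :
    listProj x I n (List.finRange k) S z = boxSection x I n S (boxEval x I n S z) := by
  refine eq_of_mem_box (g := boxSection x I n S ∘ₗ boxEval x I n S) (fun a v ha => ?_) hz
  -- Moving coordinates to the corner one by one collects the factors whose full product is
  -- `boxEval`.
  have key (s : Finset (Fin k)) : listProj x I n (List.finRange k) S (Finsupp.single a v) =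
      (∏ j ∈ s, telescopeEval (x j) n (j ∈ S) (Finsupp.single (a j) 1)) •
        listProj x I n (List.finRange k) S (Finsupp.single (s.piecewise (corner n S) a) v) := by
    induction s using Finset.induction_on with
    | empty => simp
    | insert j s hj ih =>
      have haj : s.piecewise (corner n S) a j = a j := by simp [hj]
      rw [ih, listProj_single x n _ S (List.mem_finRange j) (haj.trans_le (ha j)), smul_smul,
        Finset.prod_insert hj, mul_comm, Finset.piecewise_insert, haj]
  rw [key Finset.univ, LinearMap.comp_apply, boxEval, coordEval_single, map_smul,
    Finset.piecewise_univ]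
  rfl

lemma boxEval_single_corner (n : ℕ) (S : Finset (Fin k)) (v : I) :
    boxEval x I n S (Finsupp.single (corner n S) v) = v := by
  rw [boxEval, coordEval_single, Finset.prod_eq_one, one_smul]
  intro j _
  by_cases hj : j ∈ S <;> simp [telescopeEval_single, corner, hj]

lemma boxSection_mem_box (n : ℕ) (S : Finset (Fin k)) (v : I) :
    boxSection x I n S v ∈ box R k I n :=
  listProj_mem_box x _ S (single_mem_box (corner_le n S) v)

lemma boxEval_boxSection (n : ℕ) (S : Finset (Fin k)) (v : I) :
    boxEval x I n S (boxSection x I n S v) = v :=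
  (boxEval_listProj x _ S (single_mem_box (corner_le n S) v)).trans (boxEval_single_corner x n S v)

/-- `boxSection` inherits compatibility with the differentials from `listProj`: on a box the latter
factors through `boxEval`, which sends the differential of a corner vector to `x j ^ n • v`. -/
lemma boxSection_smul (n : ℕ) {S : Finset (Fin k)} {j : Fin k} (hj : j ∈ S) (v : I) :
    boxSection x I n S (x j ^ n • v) = cechDiff x I j (boxSection x I n (S.erase j) v) := by
  have hbox : Finsupp.single (corner n (S.erase j)) v ∈ box R k I n :=
    single_mem_box (corner_le n _) v
  have h : boxSection x I n (S.erase j) v =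
      listProj x I n (List.finRange k) (S.erase j) (Finsupp.single (corner n (S.erase j)) v) := rfl
  rw [h, ← listProj_cechDiff x n _ hj, listProj_eq_boxSection x S (cechDiff_mem_box x j hbox),
    boxEval_cechDiff x hj hbox, boxEval_single_corner]

lemma cubeMap_boxSection (n : ℕ) {q : ℕ} (w : KoszulTerm k I q) :
    cubeMap (boxSection x I n) (q + 1) (koszulCoboundary (mulEnd (fun j => x j ^ n) I) q w) =
      koszulCoboundary (cechDiff x I) q (cubeMap (boxSection x I n) q w) :=
  cubeMap_koszulCoboundary ⊤ (fun _ _ hj v _ => boxSection_smul x n hj v) (fun _ => trivial)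

lemma cubeMap_boxEval {n q : ℕ} {c : KoszulTerm k ((Fin k → ℕ) →₀ I) q}
    (hc : ∀ S, c S ∈ box R k I n) :
    cubeMap (boxEval x I n) (q + 1) (koszulCoboundary (cechDiff x I) q c) =
      koszulCoboundary (mulEnd (fun j => x j ^ n) I) q (cubeMap (boxEval x I n) q c) :=
  cubeMap_koszulCoboundary (box R k I n) (fun _ _ hj _ hz => boxEval_cechDiff x hj hz) hc

lemma cubeMap_boxEval_of_le {n m q : ℕ} (h : n ≤ m) {c : KoszulTerm k ((Fin k → ℕ) →₀ I) q}
    (hc : ∀ S, c S ∈ box R k I n) :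
    cubeMap (boxEval x I m) q c = koszulPowHom x I m n q (cubeMap (boxEval x I n) q c) := by
  funext S
  exact boxEval_of_le x h S.1 (hc S)

/-- Exactness in degree `q + 1` of the tensor product of the free resolution of the Čech complex
with `I`. -/
def CechExact (x : Fin k → R) (I : Type u) [AddCommGroup I] [Module R I] (q : ℕ) : Prop :=
  ∀ c, koszulCoboundary (cechDiff x I) (q + 1) c = 0 → ∃ b, koszulCoboundary (cechDiff x I) q b = c

/-- A cocycle `c` in the box `n` is cohomologous to the section of its evaluation in any larger box
`m`; if that evaluation is a Koszul coboundary, so is its section. -/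
lemma cechExact_of_koszul {q : ℕ}
    (H : ∀ n, 0 < n → ∃ m, n ≤ m ∧ ∀ w : KoszulTerm k I (q + 1),
      koszulCoboundary (mulEnd (fun j => x j ^ n) I) (q + 1) w = 0 →
        ∃ v, koszulCoboundary (mulEnd (fun j => x j ^ m) I) q v = koszulPowHom x I m n (q + 1) w) :
    CechExact x I q := by
  intro c hc
  -- The lower bound `1` makes `n` positive, as weak proregularity requires.
  obtain ⟨n, hn, hbox⟩ := exists_mem_box (R := R) c 1
  obtain ⟨m, hnm, hm⟩ := H n hn
  obtain ⟨v, hv⟩ := hm (cubeMap (boxEval x I n) (q + 1) c) (by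
    rw [← cubeMap_boxEval x hbox, hc, map_zero])
  rw [← cubeMap_boxEval_of_le x hnm hbox] at hv
  obtain ⟨b, hb⟩ := exists_sub_listProj x m (List.finRange k) hc
  refine ⟨b + cubeMap (boxSection x I m) q v, ?_⟩
  rw [map_add, hb, ← cubeMap_boxSection, hv, sub_add_eq_add_sub, sub_eq_iff_eq_add]
  congr 1
  funext S
  exact (listProj_eq_boxSection x S.1 (box_mono hnm (hbox S))).symm

/-- A primitive of the section of `w` lies in some box `m`; evaluating there gives a primitive of
the image of `w`. -/
lemma CechExact.koszul {q : ℕ} (H : CechExact x I q) (n : ℕ) (w : KoszulTerm k I (q + 1))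
    (hw : koszulCoboundary (mulEnd (fun j => x j ^ n) I) (q + 1) w = 0) :
    ∃ m, n ≤ m ∧ ∃ v,
      koszulCoboundary (mulEnd (fun j => x j ^ m) I) q v = koszulPowHom x I m n (q + 1) w := by
  obtain ⟨b, hb⟩ := H (cubeMap (boxSection x I n) (q + 1) w) (by
    rw [← cubeMap_boxSection, hw, map_zero])
  obtain ⟨m, hnm, hbox⟩ := exists_mem_box (R := R) b n
  refine ⟨m, hnm, cubeMap (boxEval x I m) q b, ?_⟩
  have hsec (S) : cubeMap (boxSection x I n) (q + 1) w S ∈ box R k I n :=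
    boxSection_mem_box x n S.1 _
  rw [← cubeMap_boxEval x hbox, hb, cubeMap_boxEval_of_le x hnm hsec]
  congr 1
  funext S
  exact boxEval_boxSection x n S.1 _

end Comparison

/-! ### Injective modules and cogenerators. -/

section Duality

variable {R : Type u} [CommRing R] {k : ℕ}

/-- `g` descends to `X / ker f`, which embeds in `Y`. -/
lemma exists_comp_eq_of_injective {X Y Q : Type u} [AddCommGroup X] [Module R X] [AddCommGroup Y]
    [Module R Y] [AddCommGroup Q] [Module R Q] (hQ : Module.Injective R Q)
    (f : X →ₗ[R] Y) (g : X →ₗ[R] Q) (h : ∀ z, f z = 0 → g z = 0) :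
    ∃ g' : Y →ₗ[R] Q, g' ∘ₗ f = g := by
  obtain ⟨g', hg'⟩ := hQ.out ((LinearMap.ker f).liftQ f le_rfl)
    (LinearMap.ker_eq_bot.mp (Submodule.ker_liftQ_eq_bot _ _ _ le_rfl))
    ((LinearMap.ker f).liftQ g h)
  exact ⟨g', LinearMap.ext fun z => hg' (Submodule.Quotient.mk z)⟩

lemma exists_linearMap_ne_zero {Q X : Type u} [AddCommGroup Q] [Module R Q] [AddCommGroup X]
    [Module R X] (hQ : IsCoseparator (ModuleCat.of R Q)) {z : X} (hz : z ≠ 0) :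
    ∃ g : X →ₗ[R] Q, g z ≠ 0 := by
  by_contra! H
  have h : ModuleCat.ofHom (LinearMap.toSpanSingleton R X z) = 0 :=
    (Preadditive.isCoseparator_iff _).mp hQ _ fun g => by
      ext
      simpa using H g.hom
  exact hz (by simpa using congrArg (fun f => f.hom (1 : R)) h)

lemma exists_injective_embedding (Q : Type u) [AddCommGroup Q] [Module R Q] :
    ∃ (I : Type u) (_ : AddCommGroup I) (_ : Module R I), Module.Injective R I ∧
      ∃ f : Q →ₗ[R] I, Function.Injective f :=
  ⟨(Injective.under (ModuleCat.of R Q) : ModuleCat.{u} R), inferInstance, inferInstance,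
    (Module.injective_iff_injective_object R _).mpr
      (inferInstanceAs (Injective (Injective.under (ModuleCat.of R Q)))),
    (Injective.ι (ModuleCat.of R Q)).hom, (ModuleCat.mono_iff_injective _).mp inferInstance⟩

/-! ### Koszul cochains in `I` as functionals on Koszul chains over `R`. -/

section Pairing

variable {I : Type u} [AddCommGroup I] [Module R I]

/-- The linear map on Koszul terms over `R` with the coefficients `w`. -/
def koszulPair {p : ℕ} (w : KoszulTerm k I p) : KoszulTerm k R p →ₗ[R] I :=
  ∑ S, (LinearMap.proj S : KoszulTerm k R p →ₗ[R] R).smulRight (w S)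

lemma koszulPair_apply {p : ℕ} (w : KoszulTerm k I p) (f : KoszulTerm k R p) :
    koszulPair w f = ∑ S, f S • w S := by
  simp [koszulPair]

lemma koszulPair_single {p : ℕ} (w : KoszulTerm k I p) (S) :
    koszulPair w (Pi.single S (1 : R)) = w S := by
  rw [koszulPair_apply, Finset.sum_eq_single S] <;> simp +contextual

lemma koszulPair_injective {p : ℕ} :
    Function.Injective (koszulPair : KoszulTerm k I p → KoszulTerm k R p →ₗ[R] I) :=
  fun w w' h => funext fun S => by
    rw [← koszulPair_single (R := R) w, h, koszulPair_single]

lemma exists_koszulPair_eq {p : ℕ} (g : KoszulTerm k R p →ₗ[R] I) : ∃ w, koszulPair w = g := by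
  refine ⟨fun S => g (Pi.single S 1), LinearMap.pi_ext' fun S => LinearMap.ext_ring ?_⟩
  simp [koszulPair_single]

lemma koszulPair_eq_sum {p : ℕ} (w : KoszulTerm k I p) (f : KoszulTerm k R p) :
    koszulPair w f = ∑ S : Finset (Fin k) with S.card = p, extend f S • extend w S := by
  rw [koszulPair_apply, Finset.sum_subtype (p := fun S : Finset (Fin k) => S.card = p) _ (by simp)]
  exact Finset.sum_congr rfl fun S _ => by rw [extend_coe, extend_coe]

/-- Both sides are sums over pairs matched by `(S, j) ↔ (insert j S, j)`. The signs agree because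
`sgn` counts only elements below `j`. -/
lemma koszulPair_koszulBoundary (y : Fin k → R) {p : ℕ} (w : KoszulTerm k I p)
    (f : KoszulTerm k R (p + 1)) :
    koszulPair w (koszulBoundary (mulEnd y R) p f) =
      koszulPair (koszulCoboundary (mulEnd y I) p w) f := by
  have h1 : ∀ S ∈ ({S : Finset (Fin k) | S.card = p} : Finset _),
      extend (koszulBoundary (mulEnd y R) p f) S • extend w S =
        ∑ j ∈ Sᶜ, (sgn S j * y j * extend f (insert j S)) • extend w S := fun S hS => by
    rw [extend, dif_pos (by simpa using hS), koszulBoundary_apply, Finset.sum_smul]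
    simp [mulEnd, mul_assoc]
  have h2 : ∀ S ∈ ({S : Finset (Fin k) | S.card = p + 1} : Finset _),
      extend f S • extend (koszulCoboundary (mulEnd y I) p w) S =
        ∑ j ∈ S, (sgn S j * y j * extend f S) • extend w (S.erase j) := fun S hS => by
    rw [extend, extend, dif_pos (by simpa using hS), dif_pos (by simpa using hS),
      koszulCoboundary_apply, Finset.smul_sum]
    refine Finset.sum_congr rfl fun j _ => ?_
    simp only [mulEnd, LinearMap.lsmul_apply, ← Int.cast_smul_eq_zsmul R, smul_smul]
    congr 1
    ring
  rw [koszulPair_eq_sum, koszulPair_eq_sum, Finset.sum_congr rfl h1, Finset.sum_congr rfl h2,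
    Finset.sum_sigma', Finset.sum_sigma']
  refine Finset.sum_bij' (fun a _ => ⟨insert a.2 a.1, a.2⟩) (fun a _ => ⟨a.1.erase a.2, a.2⟩)
    ?_ ?_ ?_ ?_ ?_
  · rintro ⟨S, j⟩ h
    simp only [Finset.mem_sigma, Finset.mem_filter_univ, Finset.mem_compl] at h ⊢
    exact ⟨by rw [Finset.card_insert_of_notMem h.2, h.1], by simp⟩
  · rintro ⟨S, j⟩ h
    simp only [Finset.mem_sigma, Finset.mem_filter_univ, Finset.mem_compl] at h ⊢
    exact ⟨by rw [Finset.card_erase_of_mem h.2, h.1]; rfl, by simp⟩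
  · rintro ⟨S, j⟩ h
    simp only [Finset.mem_sigma, Finset.mem_compl] at h
    simp [Finset.erase_insert h.2]
  · rintro ⟨S, j⟩ h
    simp only [Finset.mem_sigma] at h
    simp [Finset.insert_erase h.2]
  · rintro ⟨S, j⟩ h
    simp only [Finset.mem_sigma, Finset.mem_compl] at h
    simp only
    rw [← sgn_erase (insert j S), Finset.erase_insert h.2]

lemma koszulPair_koszulPowHom (x : Fin k → R) (m n : ℕ) {p : ℕ} (w : KoszulTerm k I p)
    (f : KoszulTerm k R p) :
    koszulPair w (koszulPowHom x R m n p f) = koszulPair (koszulPowHom x I m n p w) f := by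
  rw [koszulPair_apply, koszulPair_apply]
  refine Finset.sum_congr rfl fun S _ => ?_
  simp only [koszulPowHom, LinearMap.pi_apply, LinearMap.smul_apply, LinearMap.proj_apply,
    smul_smul, smul_eq_mul, mul_comm]

end Pairing

/-- A cocycle is a functional killing boundaries. Pulled back to `x^(m)` it kills cycles, whose
images are boundaries, so by injectivity it factors through the Koszul boundary map. -/
lemma IsWeaklyProregular.cechExact {x : Fin k → R} (hx : IsWeaklyProregular x)
    (I : Type u) [AddCommGroup I] [Module R I] (hI : Module.Injective R I) (q : ℕ) :
    CechExact x I q := by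
  refine cechExact_of_koszul x fun n hn => ?_
  obtain ⟨m, hnm, hm⟩ := (isWeaklyProregular_iff x).mp hx q n hn
  refine ⟨m, hnm, fun w hw => ?_⟩
  obtain ⟨g, hg⟩ := exists_comp_eq_of_injective hI (koszulBoundary (mulEnd (fun j => x j ^ m) R) q)
    (koszulPair (koszulPowHom x I m n (q + 1) w)) fun z hz => by
      obtain ⟨y, hy⟩ := hm z hz
      rw [← koszulPair_koszulPowHom, ← hy, koszulPair_koszulBoundary, hw, koszulPair_apply]
      simp
  obtain ⟨v, rfl⟩ := exists_koszulPair_eq g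
  refine ⟨v, koszulPair_injective (R := R) (.trans (LinearMap.ext fun f => ?_) hg)⟩
  exact (koszulPair_koszulBoundary _ v f).symm

lemma isWeaklyProregular_of_cechExact {x : Fin k → R}
    (H : ∀ (I : Type u) [AddCommGroup I] [Module R I], Module.Injective R I →
      ∀ q, CechExact x I q) : IsWeaklyProregular x := by
  rw [isWeaklyProregular_iff]
  intro q n _
  let B := LinearMap.range (koszulBoundary (mulEnd (fun j => x j ^ n) R) (q + 1))
  obtain ⟨I, _, _, hI, ι, hι⟩ := exists_injective_embedding (R := R) (KoszulTerm k R (q + 1) ⧸ B)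
  -- The universal cocycle: its kernel is exactly the module of boundaries, so one `m` serves every
  -- cycle.
  obtain ⟨w, hw⟩ := exists_koszulPair_eq (ι ∘ₗ B.mkQ)
  have hB (z) : koszulPair w z = 0 ↔ z ∈ B := by
    rw [hw, LinearMap.comp_apply, map_eq_zero_iff ι hι, Submodule.mkQ_apply,
      Submodule.Quotient.mk_eq_zero]
  obtain ⟨m, hnm, v, hv⟩ := (H I hI q).koszul x n w (koszulPair_injective (LinearMap.ext fun f => by
    rw [← koszulPair_koszulBoundary, (hB _).mpr ⟨f, rfl⟩, koszulPair_apply]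
    simp))
  refine ⟨m, hnm, fun z hz => (hB _).mp ?_⟩
  rw [koszulPair_koszulPowHom, ← hv, ← koszulPair_koszulBoundary, hz, map_zero]

/-! ### Tensor-hom adjunction for Čech homology. -/

section Curry

variable {I J : Type u} [AddCommGroup I] [Module R I] [AddCommGroup J] [Module R J]

/-- Tensoring with an element of `I`. -/
noncomputable def tensorElement (v : I) (p : ℕ) :
    KoszulTerm k ((Fin k → ℕ) →₀ R) p →ₗ[R] KoszulTerm k ((Fin k → ℕ) →₀ I) p :=
  cubeMap (fun _ => Finsupp.mapRange.linearMap (LinearMap.toSpanSingleton R I v)) p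

lemma tensorElement_apply (v : I) (p : ℕ) (l : KoszulTerm k ((Fin k → ℕ) →₀ R) p) (S) (a) :
    tensorElement v p l S a = l S a • v :=
  rfl

lemma tensorElement_koszulCoboundary (x : Fin k → R) (v : I) (p : ℕ)
    (l : KoszulTerm k ((Fin k → ℕ) →₀ R) p) :
    tensorElement v (p + 1) (koszulCoboundary (cechEnd x) p l) =
      koszulCoboundary (cechDiff x I) p (tensorElement v p l) :=
  cubeMap_koszulCoboundary ⊤ (fun S j _ z _ => by
    rw [cechEnd_eq_cechDiff]; exact mapRange_coordEnd _ _ _ _) fun _ => trivial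

/-- Tensor-hom adjunction for the terms of the free resolution of the Čech complex. -/
noncomputable def curryTerm {p : ℕ} (G : KoszulTerm k ((Fin k → ℕ) →₀ I) p →ₗ[R] J) :
    KoszulTerm k ((Fin k → ℕ) →₀ R) p →ₗ[R] I →ₗ[R] J :=
  LinearMap.mk₂ R (fun l v => G (tensorElement v p l)) (fun l l' v => by simp)
    (fun r l v => by simp)
    (fun l v v' => by
      rw [← map_add]; congr 1; funext S; ext a; simp [tensorElement_apply])
    (fun r l v => by
      rw [← map_smul]; congr 1; funext S; ext a; simp [tensorElement_apply, smul_comm r])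

lemma curryTerm_apply {p : ℕ} (G : KoszulTerm k ((Fin k → ℕ) →₀ I) p →ₗ[R] J) (l) (v : I) :
    curryTerm G l v = G (tensorElement v p l) :=
  rfl

lemma tensorElement_single (v : I) (p : ℕ) (S) (a : Fin k → ℕ) :
    tensorElement v p (Pi.single S (Finsupp.single a (1 : R))) =
      Pi.single S (Finsupp.single a v) := by
  funext T
  by_cases h : T = S
  · subst h; simp [tensorElement]
  · simp [tensorElement, h]

lemma curryTerm_injective {p : ℕ} : Function.Injective
    (curryTerm : (KoszulTerm k ((Fin k → ℕ) →₀ I) p →ₗ[R] J) → _) := fun G G' h => by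
  refine LinearMap.pi_ext' fun S => Finsupp.lhom_ext fun a v => ?_
  have := LinearMap.congr_fun (LinearMap.congr_fun h (Pi.single S (Finsupp.single a (1 : R)))) v
  rwa [curryTerm_apply, curryTerm_apply, tensorElement_single] at this

lemma curryTerm_surjective {p : ℕ} : Function.Surjective
    (curryTerm : (KoszulTerm k ((Fin k → ℕ) →₀ I) p →ₗ[R] J) → _) := fun g => by
  refine ⟨∑ S, (Finsupp.lsum R fun a => g (Pi.single S (Finsupp.single a 1))) ∘ₗ
    (LinearMap.proj S : KoszulTerm k ((Fin k → ℕ) →₀ I) p →ₗ[R] _), ?_⟩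
  refine LinearMap.pi_ext' fun S => Finsupp.lhom_ext' fun a => LinearMap.ext_ring ?_
  refine LinearMap.ext fun v => ?_
  simp only [LinearMap.comp_apply, Finsupp.lsingle_apply, LinearMap.single_apply, curryTerm_apply,
    tensorElement_single, LinearMap.sum_apply]
  rw [Finset.sum_eq_single S]
  · simp
  · intro T _ hT
    simp [hT]
  · simp

lemma curryTerm_comp (x : Fin k → R) {p : ℕ}
    (G : KoszulTerm k ((Fin k → ℕ) →₀ I) (p + 1) →ₗ[R] J) :
    curryTerm (G ∘ₗ koszulCoboundary (cechDiff x I) p) =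
      curryTerm G ∘ₗ koszulCoboundary (cechEnd x) p := by
  refine LinearMap.ext fun l => LinearMap.ext fun v => ?_
  rw [LinearMap.comp_apply, curryTerm_apply, curryTerm_apply, tensorElement_koszulCoboundary,
    LinearMap.comp_apply]

/-- Moves `I` from the coefficients into the complex, leaving a statement about functionals into
`J`. -/
lemma isZero_cechHomology_linearMap_iff (x : Fin k → R) (q : ℕ) :
    Limits.IsZero (cechHomology x (I →ₗ[R] J) (q + 1)) ↔
      ∀ G : KoszulTerm k ((Fin k → ℕ) →₀ I) (q + 1) →ₗ[R] J,
        G ∘ₗ koszulCoboundary (cechDiff x I) q = 0 →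
        ∃ G' : KoszulTerm k ((Fin k → ℕ) →₀ I) (q + 2) →ₗ[R] J,
          G' ∘ₗ koszulCoboundary (cechDiff x I) (q + 1) = G := by
  have h0 (p : ℕ) : curryTerm (0 : KoszulTerm k ((Fin k → ℕ) →₀ I) p →ₗ[R] J) = 0 := rfl
  rw [isZero_cechHomology_iff, curryTerm_surjective.forall]
  refine forall_congr' fun G => ?_
  rw [curryTerm_surjective.exists, ← curryTerm_comp, ← h0, curryTerm_injective.eq_iff]
  simp only [← curryTerm_comp, curryTerm_injective.eq_iff]

lemma CechExact.isZero_cechHomology {x : Fin k → R} {q : ℕ} (H : CechExact x I q)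
    (hJ : Module.Injective R J) : Limits.IsZero (cechHomology x (I →ₗ[R] J) (q + 1)) := by
  refine (isZero_cechHomology_linearMap_iff x q).mpr fun G hG =>
    exists_comp_eq_of_injective hJ _ G fun c hc => ?_
  obtain ⟨b, rfl⟩ := H c hc
  exact LinearMap.congr_fun hG b

/-- If a cocycle `c` were no coboundary, the cogenerator would give a functional that kills
coboundaries but not `c`. Vanishing homology factors it through the differential, which kills `c`.
-/
lemma cechExact_of_isZero_cechHomology {x : Fin k → R} {q : ℕ}
    (hJ : IsCoseparator (ModuleCat.of R J))
    (H : Limits.IsZero (cechHomology x (I →ₗ[R] J) (q + 1))) : CechExact x I q := by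
  intro c hc
  by_contra! hne
  let B := LinearMap.range (koszulCoboundary (cechDiff x I) q)
  obtain ⟨g, hg⟩ := exists_linearMap_ne_zero hJ (z := B.mkQ c) (fun h0 => by
    obtain ⟨b, hb⟩ := (Submodule.Quotient.mk_eq_zero B).mp h0
    exact hne b hb)
  obtain ⟨G, hG⟩ := (isZero_cechHomology_linearMap_iff x q).mp H (g ∘ₗ B.mkQ)
    (LinearMap.ext fun b => by
      rw [LinearMap.comp_apply, LinearMap.comp_apply, Submodule.mkQ_apply,
        (Submodule.Quotient.mk_eq_zero B).mpr ⟨b, rfl⟩, map_zero, LinearMap.zero_apply])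
  exact hg (by rw [← LinearMap.comp_apply, ← hG, LinearMap.comp_apply, hc, map_zero])

end Curry

end Duality

end CechKoszul

theorem proposition3p7 {R : Type u} [CommRing R] {k : ℕ} (x : Fin k → R)
    (E : Type u) [AddCommGroup E] [Module R E]
    (hE : Module.Injective R E)
    (hE' : CategoryTheory.IsCoseparator (ModuleCat.of R E)) :
    List.TFAE [
      CechKoszul.IsWeaklyProregular x,
      ∀ (I J : Type u) [AddCommGroup I] [Module R I] [AddCommGroup J] [Module R J],
        Module.Injective R I → Module.Injective R J →
        ∀ i : ℕ, 0 < i →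
          CategoryTheory.Limits.IsZero (CechKoszul.cechHomology x (I →ₗ[R] J) i),
      ∀ (I : Type u) [AddCommGroup I] [Module R I],
        Module.Injective R I →
        ∀ i : ℕ, 0 < i →
          CategoryTheory.Limits.IsZero (CechKoszul.cechHomology x (I →ₗ[R] E) i)] := by
  tfae_have 1 → 2 := by
    rintro hx I J _ _ _ _ hI hJ (_ | q) hi
    · exact absurd hi (lt_irrefl 0)
    · exact (hx.cechExact I hI q).isZero_cechHomology hJ
  tfae_have 2 → 3 := fun H I _ _ hI => H I E hI hE
  tfae_have 3 → 1 := fun H => CechKoszul.isWeaklyProregular_of_cechExact fun I _ _ hI q =>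
    CechKoszul.cechExact_of_isZero_cechHomology hE' (H I hI (q + 1) q.succ_pos)
  tfae_finish
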